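/- Let $A$ be a unital C*-algebra and let $\mathcal H$ be a (left) Hilbert $A$-module, with $A$-valued inner product $\langle\cdot,\cdot\rangle$ that is $A$-linear in the first variable, which is algebraically finitely generated or countably generated (i.e. the finite $A$-linear combinations of some countable subset are norm-dense in $\mathcal H$). Let $\mathbb J$ be a finite or countable index set. A family $\{x_j\}_{j\in\mathbb J}$ in $\mathcal H$ is called a standard frame of $\mathcal H$ if there are real constants $C,D>0$ such that for every $x\in\mathcal H$ the sum $\sum_{j}\langle x,x_j\rangle\langle x_j,x\rangle$ converges in norm in $A$ and $$C\,\langle x,x\rangle\;\le\;\sum_{j\in\mathbb J}\langle x,x_j\rangle\langle x_j,x\rangle\;\le\;D\,\langle x,x\rangle ,$$ and a standard normalized tight frame if this holds with $C=D=1$. Theorem. Every standard frame $\{x_j\}_{j\in\mathbb J}$ of $\mathcal H$ is a multiple of the sum of two standard normalized tight frames of $\mathcal H$: there are a real number $c>0$ and standard normalized tight frames $\{y_j\}_{j\in\mathbb J}$ and $\{z_j\}_{j\in\mathbb J}$ of $\mathcal H$ such that $x_j=c\,(y_j+z_j)$ for every $j\in\mathbb J$. -/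

import Mathlib

/-!
Mathlib's `CStarModule A H` is a left `A`-module with an `A`-valued inner product that is linear in
its *second* variable: `inner A x (a • y) = a * inner A x y`. The inner product `⟨x, y⟩` that is
`A`-linear in the *first* variable is therefore `inner A y x`, and
`⟨x, x_j⟩ ⟨x_j, x⟩ = inner A x_j x * inner A x x_j`.
-/

/-- A (left) module `H` over `A` with a topology is countably generated if the finite `A`-linear
combinations of the elements of some countable set are dense in `H`. -/
def IsCountablyGeneratedModule (A H : Type*) [Semiring A] [AddCommMonoid H] [Module A H]
    [TopologicalSpace H] : Prop :=
  ∃ s : Set H, s.Countable ∧ Dense (Submodule.span A s : Set H)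

section Frames

variable (A : Type*) {H J : Type*} [CStarAlgebra A] [PartialOrder A] [StarOrderedRing A]
  [NormedAddCommGroup H] [NormedSpace ℂ H] [Module A H] [IsScalarTower ℂ A H] [CStarModule A H]

/-- The family `x` in the Hilbert `A`-module `H` satisfies the frame inequality
`C ⟨v, v⟩ ≤ ∑ j, ⟨v, x j⟩ ⟨x j, v⟩ ≤ D ⟨v, v⟩` for every `v`, with constants `C, D > 0`, where the
sum converges in norm. (The terms are positive, so that norm convergence of the series in one order
and unconditional norm convergence, `Summable`, are the same.) -/
structure IsStandardFrameWith (C D : ℝ) (x : J → H) : Prop where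
  lower_pos : 0 < C
  upper_pos : 0 < D
  summable (v : H) : Summable fun j => inner A (x j) v * inner A v (x j)
  lower_le (v : H) : C • inner A v v ≤ ∑' j, inner A (x j) v * inner A v (x j)
  le_upper (v : H) : ∑' j, inner A (x j) v * inner A v (x j) ≤ D • inner A v v

/-- A standard frame of the Hilbert `A`-module `H`. -/
def IsStandardFrame (x : J → H) : Prop :=
  ∃ C D : ℝ, IsStandardFrameWith A C D x

/-- A standard normalized tight frame of the Hilbert `A`-module `H`: the frame inequality holds
with `C = D = 1`. -/
def IsStandardNormalizedTightFrame (x : J → H) : Prop :=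
  IsStandardFrameWith A 1 1 x

end Frames

namespace CStarModule

/-! ### Adjointable operators as a C⋆-algebra. -/

section Adjointable

variable {A H : Type*} [CStarAlgebra A] [PartialOrder A]
  [NormedAddCommGroup H] [NormedSpace ℂ H] [SMul A H] [CStarModule A H]

/-! An operator `W` sends the frame to a normalized tight frame as soon as `W S W⋆ = 1`, where `S`
is the frame operator. The frame bounds put the spectrum of `S` in `[C, D]`, so functional calculus
gives a self-adjoint `G = (S⁻¹ - D⁻¹)^(1/2)` commuting with `S`. Then `W = D^(-1/2) ± iG` satisfy `W
S W⋆ = D⁻¹ S + G S G = 1`, and their sum is the scalar `2 D^(-1/2)`. The analytic input is that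
adjointable operators form a C⋆-algebra (`isClosed_adjointableOperators`), that the series defining
`S` converges (`norm_sum_le`), and that bounds on the quadratic form of `S` pass to its spectrum
(`nonneg_on_spectrum_of_inner_cfc_nonneg`). -/

theorem ext_inner_left {u v : H} (h : ∀ w : H, inner A w u = inner A w v) : u = v := by
  rw [← sub_eq_zero, ← inner_self (A := A), inner_sub_right, h, sub_self]

variable (A H) in
/-- The algebra of adjointable operators on a Hilbert C⋆-module. -/
noncomputable def adjointableOperators : Subalgebra ℂ (H →L[ℂ] H) where
  carrier := {T | ∃ T' : H →L[ℂ] H, ∀ u v, inner A (T u) v = inner A u (T' v)}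
  mul_mem' := by
    rintro S T ⟨S', hS⟩ ⟨T', hT⟩
    exact ⟨T' * S', fun u v => by simp [hS, hT]⟩
  add_mem' := by
    rintro S T ⟨S', hS⟩ ⟨T', hT⟩
    exact ⟨S' + T', fun u v => by simp [hS, hT]⟩
  algebraMap_mem' r := ⟨star r • 1, fun u v => by simp [Algebra.algebraMap_eq_smul_one]⟩

/-- The adjoint of an adjointable operator, as a bounded operator. -/
noncomputable def adjointMap (T : adjointableOperators A H) : H →L[ℂ] H := T.2.choose

theorem inner_apply_left (T : adjointableOperators A H) (u v : H) :
    inner A (T.1 u) v = inner A u (adjointMap T v) := T.2.choose_spec u v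

theorem inner_adjointMap_left (T : adjointableOperators A H) (u v : H) :
    inner A (adjointMap T u) v = inner A u (T.1 v) := by
  rw [← star_inner, ← inner_apply_left, star_inner]

noncomputable instance : Star (adjointableOperators A H) where
  star T := ⟨adjointMap T, T.1, inner_adjointMap_left T⟩

theorem inner_star_left (T : adjointableOperators A H) (u v : H) :
    inner A ((star T).1 u) v = inner A u (T.1 v) := inner_adjointMap_left T u v

theorem inner_star_right (T : adjointableOperators A H) (u v : H) :
    inner A u ((star T).1 v) = inner A (T.1 u) v := (inner_apply_left T u v).symm

theorem adjointableOperators_ext {S T : adjointableOperators A H}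
    (h : ∀ u v, inner A u (S.1 v) = inner A u (T.1 v)) : S = T :=
  Subtype.ext <| ContinuousLinearMap.ext fun v => ext_inner_left (A := A) fun u => h u v

noncomputable instance : StarRing (adjointableOperators A H) where
  star_involutive T := adjointableOperators_ext fun u v => by
    rw [inner_star_right, inner_star_left]
  star_mul S T := adjointableOperators_ext fun u v => by
    rw [inner_star_right]
    change inner A (S.1 (T.1 u)) v = inner A u ((star T).1 ((star S).1 v))
    rw [inner_star_right, inner_star_right]
  star_add S T := adjointableOperators_ext fun u v => by
    rw [inner_star_right]
    change inner A (S.1 u + T.1 u) v = inner A u ((star S).1 v + (star T).1 v)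
    rw [inner_add_left, inner_add_right, inner_star_right, inner_star_right]

instance : StarModule ℂ (adjointableOperators A H) where
  star_smul c T := adjointableOperators_ext fun u v => by
    rw [inner_star_right]
    change inner A (c • T.1 u) v = inner A u (star c • (star T).1 v)
    rw [inner_smul_left_complex, inner_smul_right_complex, inner_star_right]

variable [StarOrderedRing A]

instance : CStarRing (adjointableOperators A H) where
  norm_mul_self_le T := by
    have h : ‖T.1‖ ≤ √‖star T * T‖ := by
      refine ContinuousLinearMap.opNorm_le_bound _ (Real.sqrt_nonneg _) fun v => ?_
      refine le_of_sq_le_sq ?_ (by positivity)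
      rw [mul_pow, Real.sq_sqrt (norm_nonneg (star T * T)), norm_sq_eq A, ← inner_star_right]
      calc ‖inner A v ((star T).1 (T.1 v))‖ ≤ ‖v‖ * ‖(star T * T).1 v‖ := norm_inner_le H
        _ ≤ ‖v‖ * (‖(star T * T).1‖ * ‖v‖) := by gcongr; exact ContinuousLinearMap.le_opNorm _ _
        _ = ‖star T * T‖ * ‖v‖ ^ 2 := by
          change ‖v‖ * (‖star T * T‖ * ‖v‖) = _
          ring
    calc ‖T‖ * ‖T‖ ≤ √‖star T * T‖ * √‖star T * T‖ := mul_self_le_mul_self (norm_nonneg _) h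
      _ = ‖star T * T‖ := Real.mul_self_sqrt (norm_nonneg _)

/-- By the C⋆-identity the adjoint is isometric, so the adjoints of a convergent sequence are
Cauchy; their limit is an adjoint of the limit. -/
theorem isClosed_adjointableOperators [CompleteSpace H] :
    IsClosed (adjointableOperators A H : Set (H →L[ℂ] H)) := by
  refine isClosed_of_closure_subset fun T hT => ?_
  obtain ⟨S, hS, hST⟩ := mem_closure_iff_seq_limit.1 hT
  let R (n : ℕ) : adjointableOperators A H := ⟨S n, hS n⟩
  have hR : CauchySeq R := by
    have h := hST.cauchySeq
    rw [Metric.cauchySeq_iff'] at h ⊢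
    exact h
  have hR' : CauchySeq fun n => (star (R n)).1 := by
    refine Metric.cauchySeq_iff'.2 fun ε hε => ?_
    obtain ⟨N, hN⟩ := Metric.cauchySeq_iff'.1 hR ε hε
    refine ⟨N, fun n hn => ?_⟩
    have := hN n hn
    rw [dist_eq_norm] at this
    calc dist (star (R n)).1 (star (R N)).1 = ‖star (R n - R N)‖ := by
          rw [star_sub, dist_eq_norm]
          rfl
      _ = ‖R n - R N‖ := norm_star (R n - R N)
      _ < ε := this
  obtain ⟨T', hT'⟩ := cauchySeq_tendsto_of_complete hR'
  refine ⟨T', fun u v => ?_⟩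
  have h1 : Filter.Tendsto (fun n => inner A (S n u) v) Filter.atTop (nhds (inner A (T u) v)) :=
    ((continuous_inner (A := A)).comp (Continuous.prodMk_left v)).continuousAt.tendsto.comp
      (((ContinuousLinearMap.apply ℂ H u).continuous.tendsto T).comp hST)
  have h2 : Filter.Tendsto (fun n => inner A u ((star (R n)).1 v)) Filter.atTop
      (nhds (inner A u (T' v))) :=
    ((continuous_inner (A := A)).comp (Continuous.prodMk_right u)).continuousAt.tendsto.comp
      (((ContinuousLinearMap.apply ℂ H v).continuous.tendsto T').comp hT')
  exact tendsto_nhds_unique h1 (h2.congr fun n => inner_star_right (R n) u v)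

instance [CompleteSpace H] : CompleteSpace (adjointableOperators A H) :=
  isClosed_adjointableOperators.completeSpace_coe

noncomputable instance [CompleteSpace H] : CStarAlgebra (adjointableOperators A H) where

/-- If the quadratic form of `f(S)` is positive, then `f` is nonnegative on the spectrum of `S`. -/
theorem nonneg_on_spectrum_of_inner_cfc_nonneg [CompleteSpace H] {S : adjointableOperators A H}
    (hS : IsSelfAdjoint S) {f : ℝ → ℝ} (hf : Continuous f)
    (h : ∀ v : H, 0 ≤ inner A v ((cfc f S).1 v)) {t : ℝ} (ht : t ∈ spectrum ℝ S) : 0 ≤ f t := by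
  let p (s : ℝ) : ℝ := √(-f s)
  let m (s : ℝ) : ℝ := min (f s) 0
  have hp : Continuous p := by fun_prop
  have hm : Continuous m := by fun_prop
  have hP : star (cfc p S) = cfc p S := cfc_predicate p S
  have hM : star (cfc m S) = cfc m S := cfc_predicate m S
  -- With `m` the negative part of `f` and `p = √(-m)`, `p f p = -m²`. Testing the hypothesis on
  -- `p(S) v` then gives `⟨m(S) v, m(S) v⟩ ≤ 0`, so `m(S) = 0`.
  have key : cfc p S * cfc f S * cfc p S = -(cfc m S * cfc m S) := by
    rw [← cfc_mul p f S hp.continuousOn hf.continuousOn,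
      ← cfc_mul _ p S (by fun_prop) hp.continuousOn,
      ← cfc_mul m m S hm.continuousOn hm.continuousOn, ← cfc_neg]
    congr 1
    ext s
    rcases le_total (f s) 0 with hs | hs
    · have := Real.mul_self_sqrt (neg_nonneg.2 hs)
      simp only [p, m, min_eq_left hs]
      linear_combination f s * this
    · simp [p, m, min_eq_right hs, Real.sqrt_eq_zero_of_nonpos (neg_nonpos.2 hs)]
  have hM0 : cfc m S = 0 := by
    refine Subtype.ext <| ContinuousLinearMap.ext fun v => ?_
    change (cfc m S).1 v = 0
    rw [← inner_self (A := A)]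
    refine le_antisymm ?_ inner_self_nonneg
    have h1 := h ((cfc p S).1 v)
    rw [← inner_star_right, hP] at h1
    have h2 : (cfc p S).1 ((cfc f S).1 ((cfc p S).1 v)) = -(cfc m S).1 ((cfc m S).1 v) :=
      congrArg (fun T : adjointableOperators A H => T.1 v) key
    rw [h2, inner_neg_right] at h1
    have h3 : inner A v ((cfc m S).1 ((cfc m S).1 v)) =
        inner A ((cfc m S).1 v) ((cfc m S).1 v) := by
      rw [← inner_star_right, hM]
    rw [h3] at h1
    exact neg_nonneg.1 h1
  have h0 : (spectrum ℝ S).EqOn m 0 :=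
    eqOn_of_cfc_eq_cfc (by rw [hM0]; exact (cfc_zero ℝ S).symm) hm.continuousOn
      continuousOn_const hS
  have := h0 ht
  simpa [m] using this

end Adjointable

section FrameOperator

variable {A H J : Type*} [CStarAlgebra A] [PartialOrder A] [StarOrderedRing A]
  [NormedAddCommGroup H] [NormedSpace ℂ H] [Module A H] [CStarModule A H]

/-- The Cauchy–Schwarz inequality for finite families in a C⋆-algebra. -/
theorem norm_sum_mul_star_le (F : Finset J) (a b : J → A) :
    ‖∑ j ∈ F, b j * star (a j)‖ ≤
      √‖∑ j ∈ F, a j * star (a j)‖ * √‖∑ j ∈ F, b j * star (b j)‖ := by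
  -- The sums are inner products in the Hilbert module `A^F`.
  let a' : WithCStarModule A (F → A) := (WithCStarModule.equiv A (F → A)).symm fun j => a j
  let b' : WithCStarModule A (F → A) := (WithCStarModule.equiv A (F → A)).symm fun j => b j
  have h := norm_inner_le (A := A) (WithCStarModule A (F → A)) (x := a') (y := b')
  rw [WithCStarModule.pi_norm, WithCStarModule.pi_norm, WithCStarModule.pi_inner] at h
  rw [← Finset.sum_coe_sort F, ← Finset.sum_coe_sort F, ← Finset.sum_coe_sort F]
  exact h

end FrameOperator

end CStarModule

/-! ### The frame operator and its spectrum. -/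

namespace IsStandardFrameWith

open CStarModule

variable {A H J : Type*} [CStarAlgebra A] [PartialOrder A] [StarOrderedRing A]
  [NormedAddCommGroup H] [NormedSpace ℂ H] [Module A H] [IsScalarTower ℂ A H] [CStarModule A H]
  {C D : ℝ} {x : J → H}

omit [IsScalarTower ℂ A H] in
theorem norm_sum_inner_mul_inner_le (hx : IsStandardFrameWith A C D x) (F : Finset J) (v : H) :
    ‖∑ j ∈ F, inner A (x j) v * inner A v (x j)‖ ≤ D * ‖v‖ ^ 2 := by
  have hnonneg (j : J) : 0 ≤ inner A (x j) v * inner A v (x j) := by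
    rw [← star_inner v (x j)]
    exact star_mul_self_nonneg _
  calc ‖∑ j ∈ F, inner A (x j) v * inner A v (x j)‖ ≤ ‖D • inner A v v‖ :=
        CStarAlgebra.norm_le_norm_of_nonneg_of_le (Finset.sum_nonneg fun j _ => hnonneg j)
          (((hx.summable v).sum_le_tsum F fun j _ => hnonneg j).trans (hx.le_upper v))
    _ = D * ‖v‖ ^ 2 := by
      rw [norm_smul, Real.norm_of_nonneg hx.upper_pos.le, norm_sq_eq A]

omit [IsScalarTower ℂ A H] in
-- Pair the partial sum `u` with itself: Cauchy–Schwarz and the upper frame bound at `u` bound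
-- `‖u‖²` by `√D ‖u‖` times the last factor; then cancel `‖u‖`.
theorem norm_sum_le (hx : IsStandardFrameWith A C D x) (F : Finset J) (v : H) :
    ‖∑ j ∈ F, (inner A (x j) v : A) • x j‖ ≤
      √D * √‖∑ j ∈ F, inner A (x j) v * inner A v (x j)‖ := by
  set u := ∑ j ∈ F, (inner A (x j) v : A) • x j with hu
  rcases (norm_nonneg u).eq_or_lt with h0 | h0
  · rw [← h0]
    positivity
  have h1 := norm_sum_mul_star_le F (fun j => inner A (x j) u) fun j => (inner A (x j) v : A)
  simp only [star_inner] at h1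
  have h2 : ∑ j ∈ F, inner A (x j) v * inner A u (x j) = inner A u u := by
    conv_rhs => rw [hu, inner_sum_right, ← hu]
    simp only [inner_op_smul_right]
  have h3 : √‖∑ j ∈ F, inner A (x j) u * inner A u (x j)‖ ≤ √D * ‖u‖ := by
    rw [← Real.sqrt_sq (norm_nonneg u), ← Real.sqrt_mul hx.upper_pos.le]
    exact Real.sqrt_le_sqrt (hx.norm_sum_inner_mul_inner_le F u)
  rw [h2, ← norm_sq_eq A] at h1
  refine le_of_mul_le_mul_left ?_ h0
  calc ‖u‖ * ‖u‖ ≤ √‖∑ j ∈ F, inner A (x j) u * inner A u (x j)‖ *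
        √‖∑ j ∈ F, inner A (x j) v * inner A v (x j)‖ := by rwa [← sq]
    _ ≤ √D * ‖u‖ * √‖∑ j ∈ F, inner A (x j) v * inner A v (x j)‖ := by gcongr
    _ = _ := by ring

omit [IsScalarTower ℂ A H] in
theorem summable_inner_smul [CompleteSpace H] (hx : IsStandardFrameWith A C D x) (v : H) :
    Summable fun j => (inner A (x j) v : A) • x j := by
  rw [summable_iff_vanishing_norm]
  intro ε hε
  obtain ⟨s, hs⟩ := summable_iff_vanishing_norm.1 (hx.summable v) (ε ^ 2 / D)
    (div_pos (pow_pos hε 2) hx.upper_pos)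
  refine ⟨s, fun t ht => (hx.norm_sum_le t v).trans_lt ?_⟩
  rw [← Real.sqrt_mul hx.upper_pos.le, Real.sqrt_lt' hε, mul_comm]
  exact (lt_div_iff₀ hx.upper_pos).1 (hs t ht)

/-- The map `v ↦ ∑ j, ⟨v, x j⟩ x j` as a bounded operator. -/
noncomputable def frameMap [CompleteSpace H] (hx : IsStandardFrameWith A C D x) : H →L[ℂ] H :=
  LinearMap.mkContinuous
    { toFun := fun v => ∑' j, (inner A (x j) v : A) • x j
      map_add' := fun u v => by
        simp only [CStarModule.inner_add_right, add_smul]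
        exact (hx.summable_inner_smul u).tsum_add (hx.summable_inner_smul v)
      map_smul' := fun c v => by
        simp only [inner_smul_right_complex, smul_assoc, RingHom.id_apply]
        exact (hx.summable_inner_smul v).tsum_const_smul c }
    D fun v => by
      refine le_of_tendsto (hx.summable_inner_smul v).hasSum.norm (Filter.Eventually.of_forall ?_)
      intro F
      refine (hx.norm_sum_le F v).trans ?_
      rw [← Real.sqrt_mul hx.upper_pos.le]
      refine Real.sqrt_le_iff.2 ⟨mul_nonneg hx.upper_pos.le (norm_nonneg v), ?_⟩
      calc D * ‖∑ j ∈ F, inner A (x j) v * inner A v (x j)‖ ≤ D * (D * ‖v‖ ^ 2) :=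
            mul_le_mul_of_nonneg_left (hx.norm_sum_inner_mul_inner_le F v) hx.upper_pos.le
        _ = (D * ‖v‖) ^ 2 := by ring

theorem hasSum_inner_frameMap [CompleteSpace H] (hx : IsStandardFrameWith A C D x) (u v : H) :
    HasSum (fun j => inner A (x j) v * inner A u (x j)) (inner A u (hx.frameMap v)) := by
  have h := (innerSL (A := A) u).hasSum (hx.summable_inner_smul v).hasSum
  simpa only [innerSL_apply, inner_op_smul_right] using! h

theorem inner_frameMap_left [CompleteSpace H] (hx : IsStandardFrameWith A C D x) (u v : H) :
    inner A (hx.frameMap u) v = inner A u (hx.frameMap v) := by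
  have h := (hx.hasSum_inner_frameMap v u).star
  simp only [star_mul, star_inner] at h
  exact h.unique (hx.hasSum_inner_frameMap u v)

/-- The frame operator `v ↦ ∑ j, ⟨v, x j⟩ x j` of a standard frame. -/
noncomputable def frameOperator [CompleteSpace H] (hx : IsStandardFrameWith A C D x) :
    adjointableOperators A H :=
  ⟨hx.frameMap, hx.frameMap, hx.inner_frameMap_left⟩

variable [CompleteSpace H]

theorem hasSum_inner_frameOperator (hx : IsStandardFrameWith A C D x) (u v : H) :
    HasSum (fun j => inner A (x j) v * inner A u (x j)) (inner A u (hx.frameOperator.1 v)) :=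
  hx.hasSum_inner_frameMap u v

theorem isSelfAdjoint_frameOperator (hx : IsStandardFrameWith A C D x) :
    IsSelfAdjoint hx.frameOperator :=
  adjointableOperators_ext fun u v => by
    rw [inner_star_right]
    exact hx.inner_frameMap_left u v

theorem spectrum_frameOperator_subset (hx : IsStandardFrameWith A C D x) :
    spectrum ℝ hx.frameOperator ⊆ Set.Icc C D := by
  have hS := hx.isSelfAdjoint_frameOperator
  intro t ht
  constructor
  · refine sub_nonneg.1 (nonneg_on_spectrum_of_inner_cfc_nonneg hS (f := fun s => s - C)
      (by fun_prop) (fun v => ?_) ht)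
    rw [cfc_sub _ _ hx.frameOperator, cfc_id' ℝ hx.frameOperator, cfc_const C hx.frameOperator,
      Algebra.algebraMap_eq_smul_one]
    change 0 ≤ inner A v (hx.frameOperator.1 v - C • v)
    rw [CStarModule.inner_sub_right, inner_smul_right_real,
      ← (hx.hasSum_inner_frameOperator v v).tsum_eq]
    exact sub_nonneg.2 (hx.lower_le v)
  · refine sub_nonneg.1 (nonneg_on_spectrum_of_inner_cfc_nonneg hS (f := fun s => D - s)
      (by fun_prop) (fun v => ?_) ht)
    rw [cfc_sub _ _ hx.frameOperator, cfc_id' ℝ hx.frameOperator, cfc_const D hx.frameOperator,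
      Algebra.algebraMap_eq_smul_one]
    change 0 ≤ inner A v (D • v - hx.frameOperator.1 v)
    rw [CStarModule.inner_sub_right, inner_smul_right_real,
      ← (hx.hasSum_inner_frameOperator v v).tsum_eq]
    exact sub_nonneg.2 (hx.le_upper v)

/-- If `W S W⋆ = 1` for the frame operator `S` of `x`, then `W` maps `x` to a standard normalized
tight frame. -/
theorem isStandardNormalizedTightFrame_apply (hx : IsStandardFrameWith A C D x)
    {W : adjointableOperators A H} (hW : W * hx.frameOperator * star W = 1) :
    IsStandardNormalizedTightFrame A fun j => W.1 (x j) := by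
  have h (v : H) :
      HasSum (fun j => inner A (W.1 (x j)) v * inner A v (W.1 (x j))) (inner A v v) := by
    have h1 := hx.hasSum_inner_frameOperator ((star W).1 v) ((star W).1 v)
    simp only [inner_star_right, inner_star_left] at h1
    have h2 : W.1 (hx.frameOperator.1 ((star W).1 v)) = v :=
      congrArg (fun T : adjointableOperators A H => T.1 v) hW
    rwa [h2] at h1
  exact ⟨one_pos, one_pos, fun v => (h v).summable,
    fun v => by rw [(h v).tsum_eq, one_smul], fun v => by rw [(h v).tsum_eq, one_smul]⟩

/-- Take `g(s) = √(s⁻¹ - D⁻¹)`: on the spectrum `s ≥ C > 0` makes it continuous, and `s ≤ D` makes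
the radicand nonnegative. -/
theorem exists_commute_mul_mul_eq (hx : IsStandardFrameWith A C D x) :
    ∃ G : adjointableOperators A H, IsSelfAdjoint G ∧ Commute G hx.frameOperator ∧
      G * hx.frameOperator * G = 1 - D⁻¹ • hx.frameOperator := by
  have hS := hx.isSelfAdjoint_frameOperator
  have hsp := hx.spectrum_frameOperator_subset
  have hne : ∀ s ∈ spectrum ℝ hx.frameOperator, s ≠ 0 := fun s hs =>
    (hx.lower_pos.trans_le (hsp hs).1).ne'
  let g (s : ℝ) : ℝ := √(s⁻¹ - D⁻¹)
  have hg : ContinuousOn g (spectrum ℝ hx.frameOperator) :=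
    ((continuousOn_id.inv₀ hne).sub continuousOn_const).sqrt
  refine ⟨cfc g hx.frameOperator, cfc_predicate g _, ?_, ?_⟩
  · have := cfc_commute_cfc g id hx.frameOperator
    rwa [cfc_id ℝ hx.frameOperator] at this
  · have h1 : cfc g hx.frameOperator * hx.frameOperator * cfc g hx.frameOperator =
        cfc (fun s => g s * s * g s) hx.frameOperator := by
      rw [cfc_mul (fun s => g s * s) g hx.frameOperator (hg.mul continuousOn_id) hg,
        cfc_mul g (fun s => s) hx.frameOperator hg continuousOn_id, cfc_id' ℝ hx.frameOperator]
    have h2 : cfc (fun s => 1 - D⁻¹ * s) hx.frameOperator = 1 - D⁻¹ • hx.frameOperator := by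
      rw [cfc_sub _ _ hx.frameOperator, cfc_const_one ℝ hx.frameOperator,
        cfc_const_mul_id D⁻¹ hx.frameOperator]
    rw [h1, ← h2]
    refine cfc_congr fun s hs => ?_
    have hs0 := hne s hs
    have h3 : g s * g s = s⁻¹ - D⁻¹ :=
      Real.mul_self_sqrt (sub_nonneg.2 (inv_anti₀ (hx.lower_pos.trans_le (hsp hs).1) (hsp hs).2))
    calc g s * s * g s = (g s * g s) * s := by ring
      _ = 1 - D⁻¹ * s := by rw [h3, sub_mul, inv_mul_cancel₀ hs0]

/-- For every complex square root `ω` of `-1`, the operator `D^(-1/2) + ω G` maps the frame `x` to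
a standard normalized tight frame. -/
theorem isStandardNormalizedTightFrame_add_smul (hx : IsStandardFrameWith A C D x)
    {G : adjointableOperators A H} (hG : IsSelfAdjoint G) (hGS : Commute G hx.frameOperator)
    (h : G * hx.frameOperator * G = 1 - D⁻¹ • hx.frameOperator) {ω : ℂ} (hω : ω * ω = -1)
    (hω' : star ω = -ω) :
    IsStandardNormalizedTightFrame A fun j => ((√D)⁻¹ • 1 + ω • G).1 (x j) := by
  refine hx.isStandardNormalizedTightFrame_apply ?_
  have hD : (√D)⁻¹ * (√D)⁻¹ = D⁻¹ := by rw [← mul_inv, Real.mul_self_sqrt hx.upper_pos.le]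
  have h1 : (√D)⁻¹ • (1 : adjointableOperators A H) = ((√D)⁻¹ : ℂ) • 1 := by
    rw [← Complex.ofReal_inv]
    rfl
  have h2 : D⁻¹ • hx.frameOperator = (((√D)⁻¹ : ℂ) * ((√D)⁻¹ : ℂ)) • hx.frameOperator := by
    rw [← Complex.ofReal_inv, ← Complex.ofReal_mul, hD]
    rfl
  have h3 : star ((√D : ℂ)⁻¹) = (√D : ℂ)⁻¹ := by
    rw [← Complex.ofReal_inv]
    exact Complex.conj_ofReal _
  rw [h2] at h
  rw [h1, star_add, star_smul, star_smul, hG.star_eq, star_one, h3, hω']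
  set k : ℂ := (√D : ℂ)⁻¹
  calc (k • 1 + ω • G) * hx.frameOperator * (k • 1 + -ω • G)
      = (k * k) • hx.frameOperator + (k * ω) • (G * hx.frameOperator - hx.frameOperator * G)
        - (ω * ω) • (G * hx.frameOperator * G) := by
        simp only [add_mul, mul_add, smul_mul_assoc, mul_smul_comm, one_mul, mul_one]
        module
    -- The cross terms cancel by commutation, and `ω² = -1` turns the last term into `+ G S G`.
    _ = 1 := by
        rw [h, hω, hGS.eq, sub_self]
        module

end IsStandardFrameWith

theorem mainTheorem3 {A H J : Type*} [CStarAlgebra A] [PartialOrder A] [StarOrderedRing A]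
    [NormedAddCommGroup H] [NormedSpace ℂ H] [Module A H] [IsScalarTower ℂ A H] [CStarModule A H]
    [CompleteSpace H] (hH : Module.Finite A H ∨ IsCountablyGeneratedModule A H)
    [Countable J] (x : J → H) (hx : IsStandardFrame A x) :
    ∃ (c : ℝ) (y z : J → H), 0 < c ∧
      IsStandardNormalizedTightFrame A y ∧ IsStandardNormalizedTightFrame A z ∧
      ∀ j, x j = c • (y j + z j) := by
  obtain ⟨C, D, hx⟩ := hx
  obtain ⟨G, hG, hGS, h⟩ := hx.exists_commute_mul_mul_eq
  have hD : 0 < √D := Real.sqrt_pos.2 hx.upper_pos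
  -- For `ω = ±i` the `G` terms cancel in the sum, leaving `2 (√D)⁻¹ x j`.
  refine ⟨√D / 2, _, _, by positivity,
    hx.isStandardNormalizedTightFrame_add_smul hG hGS h Complex.I_mul_I Complex.conj_I,
    hx.isStandardNormalizedTightFrame_add_smul hG hGS h (ω := -Complex.I) (by simp) (by simp),
    fun j => ?_⟩
  change x j = (√D / 2) • (((√D)⁻¹ • x j + Complex.I • G.1 (x j)) +
    ((√D)⁻¹ • x j + (-Complex.I) • G.1 (x j)))
  rw [neg_smul, add_add_add_comm, add_neg_cancel, add_zero, ← add_smul, smul_smul]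
  have h1 : √D / 2 * ((√D)⁻¹ + (√D)⁻¹) = 1 := by field_simp; norm_num
  rw [h1, one_smul]
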